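/- Let $d$ be a dimension and let $\mathbf D$ be a difference operator on complex fields over $\mathbb Z^d$, $(\mathbf Df)_\tau=\sum_{\ell=1}^k w_\ell f_{\tau-\alpha(\ell)}$ with $\alpha(\ell)\in\mathbb Z^d$, $w_\ell\in\mathbb C$. Call $\mathbf D$ regular if the vectors $\alpha(1),\dots,\alpha(k)$ span $\mathbb R^d$, all $w_\ell$ are nonzero, $\sum_\ell|w_\ell|\le 1$ and $\sum_\ell|w_\ell|\,\alpha(\ell)=0$. Write $|\tau|=\max_j|\tau_j|$, $B^t_N=\{\tau\in\mathbb Z^d:|\tau-t|\le N\}$, $B^t_N(\mathbf D)=\{\tau\in B^t_N:\tau+\alpha(\ell)\in B^t_N,\ \ell=1,\dots,k\}$, and let $\mathbf H^t_N(\mathbf D)$ be the set of fields $s:\mathbb Z^d\to\mathbb C$ with $s_\tau=(\mathbf Ds)_\tau$ for all $\tau\in B^t_N(\mathbf D)$. For reals $\theta\ge 0$, $\rho\ge 1$, $L\in\mathbb Z_{\ge0}\cup\{\infty\}$ and $t\in\mathbb Z^d$, a random field $(s_\tau)_{\tau\in\mathbb Z^d}$ is well-filtered at $t$ with parameters $\theta,\rho,L$,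 written $s\in\mathbf F^t_L(\theta,\rho)$, if for every integer $T$ with $0\le T\le L$ there is a (non-random) $q:\mathbb Z^d\to\mathbb C$ with $q_\nu=0$ for $|\nu|>T$, $\big(\sum_\nu|q_\nu|^2\big)^{1/2}\le\rho\,(2T+1)^{-d/2}$, and $$\Big[E\Big\{\Big|s_\tau-\sum_\nu q_\nu s_{\tau-\nu}\Big|^2\Big\}\Big]^{1/2}\le\theta\,(2T+1)^{-d/2}\qquad\text{for all }\tau\text{ with }|\tau-t|\le L.$$ A deterministic field is regarded as a random field that does not depend on the outcome. Proposition. Let $\mathbf D$ be a regular difference operator. Then there exists a constant $c=c(\mathbf D)>0$ such that for every integer $N>0$ and every $t\in\mathbb Z^d$, $$\mathbf H^t_N(\mathbf D)\subset\mathbf F^t_{\lfloor cN\rfloor}(0,c^{-1}).$$ -/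

import Mathlib

open MeasureTheory
open scoped ENNReal

noncomputable section

namespace WellFiltered

/-- The integer grid `ℤ^d`. -/
abbrev Grid (d : ℕ) : Type := Fin d → ℤ

/-- Deterministic complex-valued fields over `ℤ^d`. -/
abbrev Field (d : ℕ) : Type := Grid d → ℂ

/-- A random field on `ℤ^d`: `s τ ξ` is the value at the point `τ` for the outcome `ξ`. -/
abbrev RandomField (d : ℕ) (Ω : Type*) : Type _ := Grid d → Ω → ℂ

/-- `|τ| = max (|τ_1|, ..., |τ_d|)`. -/
def supNorm {d : ℕ} (τ : Grid d) : ℕ := Finset.univ.sup fun j => (τ j).natAbs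

/-- Filters: fields with finitely many nonzero entries. -/
abbrev Filt (d : ℕ) : Type := Grid d →₀ ℂ

/-- `q ∈ C_T(ℤ^d)`: the filter `q` is of order at most `T`. -/
def Filt.OrdLE {d : ℕ} (q : Filt d) (T : ℕ) : Prop := ∀ τ : Grid d, T < supNorm τ → q τ = 0

/-- The norm `|q|_2` of a filter. -/
def Filt.l2norm {d : ℕ} (q : Filt d) : ℝ := Real.sqrt (q.sum fun _ z => ‖z‖ ^ 2)

/-- The output of a filter: `(q(Δ)x)_τ = ∑_ν q_ν x_{τ-ν}`. -/
def Filt.apply {d : ℕ} (q : Filt d) (x : Field d) : Field d :=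
  fun τ => q.sum fun ν z => z * x (τ - ν)

/-- `s ∈ S^t_L(θ, ρ, T)`: the random field `s` is `T`-well-filtered, with parameters
`θ ≥ 0`, `ρ ≥ 1`, `L ∈ ℕ ∪ {∞}`, at the point `t`. The filter does not depend on the outcome. -/
def IsTWellFiltered {d : ℕ} {Ω : Type*} [MeasurableSpace Ω] (P : Measure Ω)
    (t : Grid d) (L : ℕ∞) (θ ρ : ℝ) (T : ℕ) (s : RandomField d Ω) : Prop :=
  0 ≤ θ ∧ 1 ≤ ρ ∧
  ∃ q : Filt d, q.OrdLE T ∧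
    q.l2norm ≤ ρ / (2 * (T : ℝ) + 1) ^ ((d : ℝ) / 2) ∧
    ∀ τ : Grid d, (supNorm (τ - t) : ℕ∞) ≤ L →
      (∫⁻ ξ, ‖s τ ξ - q.apply (fun ν => s ν ξ) τ‖ₑ ^ 2 ∂P) ^ (1 / 2 : ℝ)
        ≤ ENNReal.ofReal (θ * (2 * (T : ℝ) + 1) ^ (-((d : ℝ) / 2)))

/-- `F^t_L(θ, ρ)`: the random fields that are well-filtered, with parameters `θ`, `ρ`, `L`,
at the point `t`. -/
def wellFiltered {d : ℕ} {Ω : Type*} [MeasurableSpace Ω] (P : Measure Ω)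
    (t : Grid d) (L : ℕ∞) (θ ρ : ℝ) : Set (RandomField d Ω) :=
  {s | ∀ T : ℕ, (T : ℕ∞) ≤ L → IsTWellFiltered P t L θ ρ T s}

/-- The data of a difference operator `(D f)_τ = ∑_ℓ w_ℓ f_{τ - α(ℓ)}` on fields over `ℤ^d`. -/
structure DiffOp (d : ℕ) where
  /-- the number of terms -/
  k : ℕ
  /-- the shifts -/
  α : Fin k → Grid d
  /-- the weights -/
  w : Fin k → ℂ

namespace DiffOp

variable {d : ℕ} (D : DiffOp d)

/-- The action of the difference operator on fields. -/
def apply (f : Field d) : Field d := fun τ => ∑ l, D.w l * f (τ - D.α l)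

/-- A shift, viewed as a vector of `ℝ^d`. -/
def realShift (l : Fin D.k) : Fin d → ℝ := fun j => (D.α l j : ℝ)

/-- Regular difference operators. -/
structure IsRegular : Prop where
  span_eq_top : Submodule.span ℝ (Set.range D.realShift) = ⊤
  weight_ne_zero : ∀ l, D.w l ≠ 0
  sum_norm_le_one : ∑ l, ‖D.w l‖ ≤ 1
  weighted_mean_eq_zero : ∑ l, ‖D.w l‖ • D.realShift l = 0

end DiffOp

/-- The box `B^t_N = {τ : |τ - t| ≤ N}`. -/
def box {d : ℕ} (t : Grid d) (N : ℕ) : Set (Grid d) := {τ | supNorm (τ - t) ≤ N}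

/-- `B^t_N(D) = {τ ∈ B^t_N : τ + α(ℓ) ∈ B^t_N for all ℓ}`. -/
def DiffOp.innerBox {d : ℕ} (D : DiffOp d) (t : Grid d) (N : ℕ) : Set (Grid d) :=
  {τ | τ ∈ box t N ∧ ∀ l, τ + D.α l ∈ box t N}

/-- `H^t_N(D)`: the fields with `s_τ = (D s)_τ` for all `τ ∈ B^t_N(D)`. -/
def DiffOp.solutions {d : ℕ} (D : DiffOp d) (t : Grid d) (N : ℕ) : Set (Field d) :=
  {s | ∀ τ ∈ D.innerBox t N, s τ = D.apply s τ}

/-- A deterministic field, viewed as a random field that does not depend on the outcome. -/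
def Field.toRandom {d : ℕ} (Ω : Type*) (s : Field d) : RandomField d Ω := fun τ _ => s τ

end WellFiltered

end

namespace WellFiltered

/-! ### Smoothing of bounded subsolutions -/

/-! The modulus `u` of a solution is subharmonic for the centered weights `‖w l‖`. A mean value
inequality bounds `u 0` by `C (2T+1)^(-d)` times its sum over the box of radius `T`. By
Cauchy–Schwarz, evaluation at 0 then has ℓ² norm at most `C (2T+1)^(-d/2)` on the solutions
restricted to that box. Its Riesz representer is a filter that reproduces solutions exactly, and
translation makes the same filter work at every point far enough inside the big box.

The mean value inequality needs no heat kernel. Subtracting a paraboloid and truncating makes `u` a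
compactly supported subsolution with error `e` of order `M / r^2` (`isSubsolution_parabolicCutoff`).
Averaging with a translate by a difference of two shifts costs only `e / (2c)` in the supremum.
Averaging `m` times in each of `d` independent directions spreads the mass with weights at most
`(m+1)^(-d/2)` (`IsSubsolution.le_sum_support`). With `m` of order `r^2` the accumulated error is
absorbed, provided `u ≤ 2^d u x₀` near `x₀`; a weighted maximum supplies such an `x₀`. -/

theorem succ_mul_centralBinom_sq_le (k : ℕ) : (2 * k + 1) * k.centralBinom ^ 2 ≤ 16 ^ k := by
  induction k with
  | zero => simp
  | succ k ih =>
    have h := Nat.succ_mul_centralBinom_succ k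
    have h2 : (k + 1) ^ 2 * ((2 * (k + 1) + 1) * (k + 1).centralBinom ^ 2)
        ≤ (k + 1) ^ 2 * 16 ^ (k + 1) := by
      calc (k + 1) ^ 2 * ((2 * (k + 1) + 1) * (k + 1).centralBinom ^ 2)
          = (2 * k + 3) * ((k + 1) * (k + 1).centralBinom) ^ 2 := by ring
        _ = 4 * (2 * k + 1) * (2 * k + 3) * ((2 * k + 1) * k.centralBinom ^ 2) := by
            rw [h]; ring
        _ ≤ 4 * (2 * k + 1) * (2 * k + 3) * 16 ^ k := by gcongr
        _ ≤ 16 * (k + 1) ^ 2 * 16 ^ k := by gcongr ?_ * _; nlinarith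
        _ = (k + 1) ^ 2 * 16 ^ (k + 1) := by ring
    exact Nat.le_of_mul_le_mul_left h2 (by positivity)

theorem succ_mul_choose_sq_le (m j : ℕ) : (m + 1) * m.choose j ^ 2 ≤ 4 ^ m := by
  refine le_trans (Nat.mul_le_mul_left _ (Nat.pow_le_pow_left (Nat.choose_le_middle j m) 2)) ?_
  obtain ⟨k, rfl | rfl⟩ := Nat.even_or_odd' m
  · have h := succ_mul_centralBinom_sq_le k
    rw [Nat.centralBinom] at h
    rw [Nat.mul_div_cancel_left k two_pos, pow_mul]
    exact h
  · have h := succ_mul_centralBinom_sq_le (k + 1)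
    -- The middle coefficient of an odd row is half of the next central binomial coefficient.
    have h1 : (k + 1).centralBinom = 2 * (2 * k + 1).choose k := by
      rw [Nat.centralBinom, show 2 * (k + 1) = (2 * k + 1) + 1 by ring, Nat.choose_succ_succ,
        Nat.choose_symm_half]
      ring
    rw [h1] at h
    rw [show (2 * k + 1) / 2 = k by omega, pow_succ 4, pow_mul]
    rw [pow_succ 16] at h
    norm_num
    nlinarith [Nat.zero_le (((2 * k + 1).choose k) ^ 2)]

theorem choose_le_two_pow_div_sqrt (m j : ℕ) :
    (m.choose j : ℝ) ≤ 2 ^ m * (1 / Real.sqrt (m + 1)) := by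
  rw [mul_one_div, le_div_iff₀ (by positivity)]
  refine le_of_sq_le_sq ?_ (by positivity)
  rw [mul_pow, Real.sq_sqrt (by positivity), ← pow_mul, mul_comm m 2, pow_mul]
  norm_num
  have := succ_mul_choose_sq_le m j
  rw [mul_comm]
  exact_mod_cast this

section Smoothing

variable {G : Type*} [AddCommGroup G] {ι : Type*} [Fintype ι]

/-- Bounded nonnegative functions `f` with `f ≤ ∑ l, p l • f (· - α l) + e`. -/
structure IsSubsolution (p : ι → ℝ) (α : ι → G) (e : ℝ) (f : G → ℝ) : Prop where
  nonneg : ∀ x, 0 ≤ f x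
  bddAbove : BddAbove (Set.range f)
  le : ∀ x, f x ≤ ∑ l, p l * f (x - α l) + e

/-- The mean of a function and its translate. -/
noncomputable def translateMean (β : G) (f : G → ℝ) : G → ℝ := fun x => (f x + f (x + β)) / 2

variable {p : ι → ℝ} {α : ι → G} {e : ℝ} {f : G → ℝ}

theorem IsSubsolution.translateMean (hf : IsSubsolution p α e f) (β : G) :
    IsSubsolution p α e (translateMean β f) where
  nonneg x := by
    have := hf.nonneg x; have := hf.nonneg (x + β)
    unfold WellFiltered.translateMean; linarith
  bddAbove := by
    obtain ⟨B, hB⟩ := hf.bddAbove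
    refine ⟨B, ?_⟩
    rintro _ ⟨x, rfl⟩
    have h1 := hB ⟨x, rfl⟩; have h2 := hB ⟨x + β, rfl⟩
    simp only [WellFiltered.translateMean]; linarith
  le x := by
    have h1 := hf.le x; have h2 := hf.le (x + β)
    simp only [WellFiltered.translateMean]
    have : ∑ l, p l * ((f (x - α l) + f (x - α l + β)) / 2)
        = (∑ l, p l * f (x - α l) + ∑ l, p l * f (x + β - α l)) / 2 := by
      rw [← Finset.sum_add_distrib, Finset.sum_div]
      refine Finset.sum_congr rfl fun l _ => ?_
      rw [sub_add_eq_add_sub]; ring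
    rw [this]; linarith

/-- Split off weight `c` at each of the shifts `a` and `b`: these two terms form `2c` times a
translate mean, and the rest is at most `(1 - 2c) sup f`. Taking suprema and solving for `sup f`
gives the bound. -/
theorem IsSubsolution.le_of_translateMean_le (hf : IsSubsolution p α e f)
    (hp1 : ∑ l, p l ≤ 1) {c : ℝ} (hc : 0 < c) (hcp : ∀ l, c ≤ p l) {a b : ι} (hab : a ≠ b)
    {M : ℝ} (hM : ∀ x, WellFiltered.translateMean (α a - α b) f x ≤ M) (x : G) :
    f x ≤ M + e / (2 * c) := by
  classical
  have hS : ∀ y, f y ≤ ⨆ y, f y := fun y => le_ciSup hf.bddAbove y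
  set S := ⨆ y, f y with hSdef
  have hS0 : 0 ≤ S := (hf.nonneg x).trans (hS x)
  have key : ∀ y, f y ≤ 2 * c * M + (1 - 2 * c) * S + e := by
    intro y
    -- Since `a ≠ b`, no weight loses more than `c`, so `p'` stays nonnegative.
    let p' : ι → ℝ := fun l => p l - (if l = a then c else 0) - (if l = b then c else 0)
    have hp' : ∀ l, 0 ≤ p' l := by
      intro l
      have := hcp l
      simp only [p']
      split_ifs with h1 h2
      · exact absurd (h1.symm.trans h2) hab
      all_goals linarith
    have hsum : ∑ l, p' l = ∑ l, p l - 2 * c := by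
      simp only [p', Finset.sum_sub_distrib, Finset.sum_ite_eq', Finset.mem_univ, if_true]; ring
    have hsplit : ∑ l, p l * f (y - α l)
        = ∑ l, p' l * f (y - α l) + c * f (y - α a) + c * f (y - α b) := by
      simp only [p', sub_mul, Finset.sum_sub_distrib, ite_mul, zero_mul, Finset.sum_ite_eq',
        Finset.mem_univ, if_true]
      ring
    have h1 : ∑ l, p' l * f (y - α l) ≤ (1 - 2 * c) * S := by
      calc ∑ l, p' l * f (y - α l) ≤ ∑ l, p' l * S :=
            Finset.sum_le_sum fun l _ => mul_le_mul_of_nonneg_left (hS _) (hp' l)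
        _ = (∑ l, p l - 2 * c) * S := by rw [← Finset.sum_mul, hsum]
        _ ≤ (1 - 2 * c) * S := by gcongr
    have h2 := hM (y - α a)
    simp only [WellFiltered.translateMean, sub_add_sub_cancel] at h2
    have h3 := hf.le y
    rw [hsplit] at h3
    nlinarith
  have hne : Nonempty G := ⟨x⟩
  have hSle : S ≤ 2 * c * M + (1 - 2 * c) * S + e := ciSup_le key
  have : S ≤ M + e / (2 * c) := by
    rw [← sub_le_iff_le_add', le_div_iff₀ (by positivity)]; linarith
  exact (hS x).trans this

theorem IsSubsolution.iterate_translateMean (hf : IsSubsolution p α e f) (β : G) (m : ℕ) :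
    IsSubsolution p α e ((WellFiltered.translateMean β)^[m] f) := by
  induction m with
  | zero => exact hf
  | succ m ih => rw [Function.iterate_succ_apply']; exact ih.translateMean β

theorem IsSubsolution.le_of_iterate_translateMean_le (hf : IsSubsolution p α e f)
    (hp1 : ∑ l, p l ≤ 1) {c : ℝ} (hc : 0 < c) (hcp : ∀ l, c ≤ p l) {a b : ι} (hab : a ≠ b)
    (m : ℕ) {M : ℝ} (hM : ∀ x, (WellFiltered.translateMean (α a - α b))^[m] f x ≤ M) (x : G) :
    f x ≤ M + m * (e / (2 * c)) := by
  induction m generalizing M with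
  | zero => simpa using hM x
  | succ m ih =>
    have := ih (M := M + e / (2 * c)) fun y =>
      (hf.iterate_translateMean (α a - α b) m).le_of_translateMean_le hp1 hc hcp hab
        (fun z => (congrFun (Function.iterate_succ_apply' _ m f) z).symm.trans_le (hM z)) y
    push_cast
    linarith

/-- This is the binomial theorem for `(S + 1) ^ m`, with `S` the translation by `β`. -/
theorem iterate_translateMean_apply (β : G) (f : G → ℝ) (m : ℕ) (x : G) :
    2 ^ m * (translateMean β)^[m] f x
      = ∑ j ∈ Finset.range (m + 1), (m.choose j : ℝ) * f (x + j • β) := by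
  let S : Module.End ℝ (G → ℝ) :=
    { toFun := fun g y => g (y + β), map_add' := fun _ _ => rfl, map_smul' := fun _ _ => rfl }
  have hS : ∀ (j : ℕ) (g : G → ℝ) (y : G), (S ^ j) g y = g (y + j • β) := by
    intro j
    induction j with
    | zero => intro g y; simp
    | succ j ih =>
      intro g y
      rw [pow_succ, Module.End.mul_apply, ih, succ_nsmul, ← add_assoc]
      rfl
  have h1 : ∀ m : ℕ, ((S + 1) ^ m) f = (2 : ℝ) ^ m • (translateMean β)^[m] f := by
    intro m
    induction m with
    | zero => simp
    | succ m ih =>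
      rw [pow_succ', Module.End.mul_apply, ih, Function.iterate_succ_apply']
      ext y
      simp only [map_smul, Pi.smul_apply, LinearMap.add_apply, Module.End.one_apply,
        Pi.add_apply, smul_eq_mul, translateMean]
      rw [show S ((translateMean β)^[m] f) y = (translateMean β)^[m] f (y + β) from rfl]
      ring
  have h2 := congrFun (h1 m) x
  rw [Pi.smul_apply, smul_eq_mul] at h2
  rw [← h2, (Commute.one_right S).add_pow, LinearMap.sum_apply, Finset.sum_apply]
  refine Finset.sum_congr rfl fun j _ => ?_
  rw [one_pow, mul_one, ← Nat.cast_comm, ← nsmul_eq_mul, LinearMap.smul_apply, Pi.smul_apply, hS,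
    nsmul_eq_mul]

theorem iterate_translateMean_le (β : G) (hf : ∀ x, 0 ≤ f x) (m : ℕ) (x : G) :
    (translateMean β)^[m] f x ≤ 1 / Real.sqrt (m + 1) * ∑ j : Fin (m + 1), f (x + (j : ℕ) • β) := by
  have h2 : (0 : ℝ) < 2 ^ m := by positivity
  refine le_of_mul_le_mul_left ?_ h2
  rw [iterate_translateMean_apply, Fin.sum_univ_eq_sum_range (fun j => f (x + j • β)),
    ← mul_assoc, Finset.mul_sum]
  exact Finset.sum_le_sum fun j _ =>
    mul_le_mul_of_nonneg_right (choose_le_two_pow_div_sqrt m j) (hf _)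

theorem IsSubsolution.le_sum_translates (hf : IsSubsolution p α e f)
    (hp1 : ∑ l, p l ≤ 1) {c : ℝ} (hc : 0 < c) (hcp : ∀ l, c ≤ p l) (m : ℕ) {n : ℕ}
    (a b : Fin n → ι) (hab : ∀ i, a i ≠ b i) {M : ℝ}
    (hM : ∀ x, (1 / Real.sqrt (m + 1)) ^ n *
      ∑ j : Fin n → Fin (m + 1), f (x + ∑ i, (j i : ℕ) • (α (a i) - α (b i))) ≤ M) (x : G) :
    f x ≤ M + n * (m * (e / (2 * c))) := by
  induction n generalizing f M x with
  | zero => simpa using hM x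
  | succ n ih =>
    set β := α (a 0) - α (b 0) with hβ
    have hg := hf.iterate_translateMean β m
    have h := hf.le_of_iterate_translateMean_le hp1 hc hcp (hab 0) m
      (M := M + n * (m * (e / (2 * c)))) ?_ x
    · push_cast; linarith
    refine fun y => ih hg (fun i => a i.succ) (fun i => b i.succ) (fun i => hab i.succ)
      (fun z => ?_) y
    refine le_trans ?_ (hM z)
    rw [pow_succ, mul_assoc]
    refine mul_le_mul_of_nonneg_left ?_ (by positivity)
    refine (Finset.sum_le_sum fun j _ => iterate_translateMean_le β hf.nonneg m _).trans ?_
    rw [← Finset.mul_sum]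
    refine le_of_eq ?_
    congr 1
    -- The steps in direction 0 and those in the remaining directions combine into one multi-index.
    rw [Finset.sum_comm, ← Fintype.sum_prod_type',
      ← (Fin.consEquiv (fun _ : Fin (n + 1) => Fin (m + 1))).sum_comp]
    refine Fintype.sum_congr _ _ fun q => ?_
    congr 1
    simp only [Fin.consEquiv_apply, Fin.sum_univ_succ, Fin.cons_zero, Fin.cons_succ]
    abel

/-- A subsolution supported on a finite set `A` is bounded by its mass spread over
`(m + 1) ^ (n / 2)` points, where `n` is the number of independent directions. -/
theorem IsSubsolution.le_sum_support (hf : IsSubsolution p α e f)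
    (hp1 : ∑ l, p l ≤ 1) {c : ℝ} (hc : 0 < c) (hcp : ∀ l, c ≤ p l) (m : ℕ) {n : ℕ}
    (a b : Fin n → ι) (hab : ∀ i, a i ≠ b i)
    (hinj : Function.Injective fun j : Fin n → ℕ => ∑ i, j i • (α (a i) - α (b i)))
    {A : Finset G} (hA : ∀ x ∉ A, f x = 0) (x : G) :
    f x ≤ (1 / Real.sqrt (m + 1)) ^ n * ∑ y ∈ A, f y + n * (m * (e / (2 * c))) := by
  classical
  refine hf.le_sum_translates hp1 hc hcp m a b hab (fun z => ?_) x
  refine mul_le_mul_of_nonneg_left ?_ (by positivity)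
  let φ : (Fin n → Fin (m + 1)) → G := fun j => z + ∑ i, (j i : ℕ) • (α (a i) - α (b i))
  have hφ : Function.Injective φ := by
    intro j j' h
    have := hinj (add_left_cancel h : (∑ i, (j i : ℕ) • (α (a i) - α (b i))) = _)
    funext i
    exact Fin.ext (congrFun this i)
  calc ∑ j, f (φ j) = ∑ y ∈ Finset.univ.image φ, f y :=
        (Finset.sum_image (hφ.injOn)).symm
    _ ≤ ∑ y ∈ Finset.univ.image φ ∪ A, f y :=
        Finset.sum_le_sum_of_subset_of_nonneg Finset.subset_union_left fun _ _ _ => hf.nonneg _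
    _ = ∑ y ∈ A, f y := (Finset.sum_subset Finset.subset_union_right fun y _ hy => hA y hy).symm

end Smoothing

/-! ### The sup norm and finite boxes -/

section Boxes

variable {d : ℕ}

theorem supNorm_le_iff {τ : Grid d} {n : ℕ} : supNorm τ ≤ n ↔ ∀ j, (τ j).natAbs ≤ n := by
  simp [supNorm, Finset.sup_le_iff]

theorem natAbs_le_supNorm (τ : Grid d) (j : Fin d) : (τ j).natAbs ≤ supNorm τ :=
  supNorm_le_iff.1 le_rfl j

theorem supNorm_zero : supNorm (0 : Grid d) = 0 :=
  Nat.le_zero.1 (supNorm_le_iff.2 fun _ => by simp)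

theorem supNorm_neg (τ : Grid d) : supNorm (-τ) = supNorm τ := by simp [supNorm]

theorem supNorm_add_le (σ τ : Grid d) : supNorm (σ + τ) ≤ supNorm σ + supNorm τ :=
  supNorm_le_iff.2 fun j => (Int.natAbs_add_le _ _).trans
    (add_le_add (natAbs_le_supNorm σ j) (natAbs_le_supNorm τ j))

theorem supNorm_sub_le (σ τ : Grid d) : supNorm (σ - τ) ≤ supNorm σ + supNorm τ := by
  rw [sub_eq_add_neg, ← supNorm_neg τ]
  exact supNorm_add_le _ _

/-- The finite set of points of sup norm at most `n`. -/
noncomputable def boxFinset (d n : ℕ) : Finset (Grid d) :=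
  Fintype.piFinset fun _ => Finset.Icc (-(n : ℤ)) n

theorem mem_boxFinset {n : ℕ} {τ : Grid d} : τ ∈ boxFinset d n ↔ supNorm τ ≤ n := by
  rw [boxFinset, Fintype.mem_piFinset, supNorm_le_iff]
  refine forall_congr' fun j => ?_
  rw [Finset.mem_Icc]
  omega

theorem card_boxFinset (d n : ℕ) : (boxFinset d n).card = (2 * n + 1) ^ d := by
  simp only [boxFinset, Fintype.card_piFinset, Int.card_Icc, Finset.prod_const, Finset.card_univ,
    Fintype.card_fin]
  congr 1
  omega

theorem supNorm_sq_le_sum_sq (τ : Grid d) : ((supNorm τ : ℕ) : ℝ) ^ 2 ≤ ∑ j, (τ j : ℝ) ^ 2 := by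
  rcases isEmpty_or_nonempty (Fin d) with h | h
  · simp [supNorm]
  · obtain ⟨j, -, hj⟩ := Finset.exists_mem_eq_sup Finset.univ Finset.univ_nonempty
      fun j => (τ j).natAbs
    have h1 : ((supNorm τ : ℕ) : ℝ) ^ 2 = (τ j : ℝ) ^ 2 := by
      rw [supNorm, hj, Nat.cast_natAbs, Int.cast_abs, sq_abs]
    rw [h1]
    exact Finset.single_le_sum (f := fun j => (τ j : ℝ) ^ 2) (fun _ _ => sq_nonneg _)
      (Finset.mem_univ j)

end Boxes

/-! ### Directions of a regular operator -/

/-- The shifts of a centered family that spans `ℝ^d` have `d` independent differences. -/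
theorem DiffOp.IsRegular.exists_injective_directions {d : ℕ} {D : DiffOp d} (hD : D.IsRegular) :
    ∃ a b : Fin d → Fin D.k, (∀ i, a i ≠ b i) ∧
      Function.Injective fun j : Fin d → ℕ => ∑ i, j i • (D.α (a i) - D.α (b i)) := by
  rcases Nat.eq_zero_or_pos d with rfl | hd
  · exact ⟨Fin.elim0, Fin.elim0, fun i => i.elim0, fun _ _ _ => Subsingleton.elim _ _⟩
  have hk : Nonempty (Fin D.k) := by
    by_contra hk
    rw [not_nonempty_iff] at hk
    have h := hD.span_eq_top
    rw [Set.range_eq_empty, Submodule.span_empty] at h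
    have : Nontrivial (Fin d → ℝ) := by
      have : Nonempty (Fin d) := ⟨⟨0, hd⟩⟩
      infer_instance
    exact bot_ne_top h
  obtain ⟨l₀⟩ := hk
  let β : Fin D.k → Fin d → ℝ := fun l => D.realShift l - D.realShift l₀
  -- Centering gives `∑ ‖w l‖ β l = -(∑ ‖w l‖) α(l₀)`, so `α(l₀)`, and with it every shift, lies in
  -- the span of the differences.
  have hspan : Submodule.span ℝ (Set.range β) = ⊤ := by
    have hβ : ∀ l, β l ∈ Submodule.span ℝ (Set.range β) := fun l =>
      Submodule.subset_span ⟨l, rfl⟩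
    have hpos : 0 < ∑ l, ‖D.w l‖ :=
      Finset.sum_pos (fun l _ => norm_pos_iff.2 (hD.weight_ne_zero l)) ⟨l₀, Finset.mem_univ _⟩
    have h0 : D.realShift l₀ ∈ Submodule.span ℝ (Set.range β) := by
      have h1 : ∑ l, ‖D.w l‖ • β l = -((∑ l, ‖D.w l‖) • D.realShift l₀) := by
        simp only [β, smul_sub, Finset.sum_sub_distrib, hD.weighted_mean_eq_zero, Finset.sum_smul,
          zero_sub]
      have h2 : (∑ l, ‖D.w l‖) • D.realShift l₀ ∈ Submodule.span ℝ (Set.range β) := by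
        rw [← Submodule.neg_mem_iff, ← h1]
        exact Submodule.sum_mem _ fun l _ => Submodule.smul_mem _ _ (hβ l)
      exact (Submodule.smul_mem_iff _ hpos.ne').1 h2
    rw [eq_top_iff, ← hD.span_eq_top, Submodule.span_le]
    rintro _ ⟨l, rfl⟩
    have := Submodule.add_mem _ (hβ l) h0
    simpa [β] using this
  obtain ⟨κ, a, ha, hs, hli⟩ := exists_linearIndependent' ℝ β
  rw [hspan] at hs
  have hfin : Finite κ := Finite.of_injective a ha
  have := Fintype.ofFinite κ
  have hcard : Fintype.card κ = d := by
    have h1 := finrank_span_eq_card hli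
    rw [hs, finrank_top, Module.finrank_fin_fun] at h1
    exact h1.symm
  let e : Fin d ≃ κ := (Fintype.equivFinOfCardEq hcard).symm
  have hli' : LinearIndependent ℝ fun i => β (a (e i)) := hli.comp e e.injective
  refine ⟨fun i => a (e i), fun _ => l₀, fun i hi => hli'.ne_zero i ?_, fun j j' h => ?_⟩
  · simp only [β, hi, sub_self]
  · have h1 : ∑ i, (j i : ℝ) • β (a (e i)) = ∑ i, (j' i : ℝ) • β (a (e i)) := by
      funext t
      have := congrArg (fun z : ℤ => (z : ℝ)) (congrFun h t)
      simpa [β, Finset.sum_apply, DiffOp.realShift] using this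
    funext i
    have h2 := (Fintype.linearIndependent_iffₛ.1 hli')
      (fun i => (j i : ℝ)) (fun i => (j' i : ℝ)) h1 i
    exact_mod_cast h2

/-! ### The mean value inequality for subharmonic functions -/

section MeanValue

variable {d : ℕ} {ι : Type*} [Fintype ι] {p : ι → ℝ} {α : ι → Grid d}

/-- The squared Euclidean norm. -/
noncomputable def sqNorm (τ : Grid d) : ℝ := ∑ j, (τ j : ℝ) ^ 2

theorem sqNorm_nonneg (τ : Grid d) : 0 ≤ sqNorm τ := Finset.sum_nonneg fun _ _ => sq_nonneg _

/-- Centering kills the cross term, so averaging raises the paraboloid by at most a constant when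
the total weight is at most 1. -/
theorem sum_mul_sqNorm_sub (hmean : ∀ j, ∑ l, p l * (α l j : ℝ) = 0) (y : Grid d) :
    ∑ l, p l * sqNorm (y - α l) = (∑ l, p l) * sqNorm y + ∑ l, p l * sqNorm (α l) := by
  have h : ∀ l, p l * sqNorm (y - α l)
      = p l * sqNorm y + p l * sqNorm (α l) - 2 * ∑ j, (y j : ℝ) * (p l * (α l j : ℝ)) := by
    intro l
    simp only [sqNorm, Finset.mul_sum]
    rw [← Finset.sum_add_distrib, ← Finset.sum_sub_distrib]
    refine Finset.sum_congr rfl fun j _ => ?_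
    rw [Pi.sub_apply, Int.cast_sub]
    ring
  have h0 : ∑ l, ∑ j, (y j : ℝ) * (p l * (α l j : ℝ)) = 0 := by
    rw [Finset.sum_comm]
    exact Finset.sum_eq_zero fun j _ => by rw [← Finset.mul_sum, hmean j, mul_zero]
  rw [Finset.sum_congr rfl fun l _ => h l, Finset.sum_sub_distrib, Finset.sum_add_distrib,
    ← Finset.mul_sum, h0, Finset.sum_mul]
  ring

/-- The positive part of `u` minus a paraboloid centered at `x₀`, cut off outside the box of
radius `r` around `x₀`. -/
noncomputable def parabolicCutoff (u : Grid d → ℝ) (M : ℝ) (r : ℕ) (x₀ x : Grid d) : ℝ :=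
  if supNorm (x - x₀) ≤ r then max (u x - M / (r : ℝ) ^ 2 * sqNorm (x - x₀)) 0 else 0

/-- One step from the box of radius `r` reaches at most radius `r + K`. Outside radius `r` the
paraboloid is already at least `M ≥ u`, so the truncation loses nothing there, and the only error is
the paraboloid's own increment. -/
theorem isSubsolution_parabolicCutoff (hp : ∀ l, 0 ≤ p l) (hp1 : ∑ l, p l ≤ 1)
    (hmean : ∀ j, ∑ l, p l * (α l j : ℝ) = 0) {K : ℕ} (hK : ∀ l, supNorm (α l) ≤ K)
    {u : Grid d → ℝ} {x₀ : Grid d} {r : ℕ} (hr : 0 < r) {M : ℝ} (hM : 0 ≤ M)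
    (hu : ∀ x, supNorm (x - x₀) ≤ r → u x ≤ ∑ l, p l * u (x - α l))
    (huM : ∀ x, supNorm (x - x₀) ≤ r + K → u x ≤ M) :
    IsSubsolution p α (M / (r : ℝ) ^ 2 * ∑ l, p l * sqNorm (α l)) (parabolicCutoff u M r x₀) := by
  have hr' : (0 : ℝ) < (r : ℝ) ^ 2 := by positivity
  have hMr : 0 ≤ M / (r : ℝ) ^ 2 := by positivity
  have hnonneg : ∀ x, 0 ≤ parabolicCutoff u M r x₀ x := by
    intro x
    unfold parabolicCutoff
    split_ifs
    exacts [le_max_right _ _, le_rfl]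
  have he : 0 ≤ M / (r : ℝ) ^ 2 * ∑ l, p l * sqNorm (α l) :=
    mul_nonneg hMr (Finset.sum_nonneg fun l _ => mul_nonneg (hp l) (sqNorm_nonneg _))
  have hle : ∀ x, supNorm (x - x₀) ≤ r + K →
      u x - M / (r : ℝ) ^ 2 * sqNorm (x - x₀) ≤ parabolicCutoff u M r x₀ x := by
    intro x hx
    unfold parabolicCutoff
    split_ifs with h
    · exact le_max_left _ _
    · have h1 : (r : ℝ) ^ 2 ≤ sqNorm (x - x₀) := by
        refine le_trans ?_ (supNorm_sq_le_sum_sq _)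
        have : r ≤ supNorm (x - x₀) := by omega
        gcongr
      have h2 : M ≤ M / (r : ℝ) ^ 2 * sqNorm (x - x₀) := by
        calc M = M / (r : ℝ) ^ 2 * (r : ℝ) ^ 2 := by field_simp
          _ ≤ _ := by gcongr
      linarith [huM x hx]
  refine ⟨hnonneg, ⟨M, ?_⟩, fun x => ?_⟩
  · rintro _ ⟨x, rfl⟩
    unfold parabolicCutoff
    split_ifs with h
    · refine max_le ?_ hM
      have := mul_nonneg hMr (sqNorm_nonneg (x - x₀))
      linarith [huM x (by omega)]
    · exact hM
  · have hsum : 0 ≤ ∑ l, p l * parabolicCutoff u M r x₀ (x - α l) :=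
      Finset.sum_nonneg fun l _ => mul_nonneg (hp l) (hnonneg _)
    by_cases h : supNorm (x - x₀) ≤ r
    · conv_lhs => rw [parabolicCutoff, if_pos h]
      refine max_le ?_ (by linarith)
      have h1 : ∑ l, p l * (u (x - α l) - M / (r : ℝ) ^ 2 * sqNorm (x - α l - x₀))
          ≤ ∑ l, p l * parabolicCutoff u M r x₀ (x - α l) := by
        refine Finset.sum_le_sum fun l _ => mul_le_mul_of_nonneg_left (hle _ ?_) (hp l)
        rw [sub_right_comm]
        exact (supNorm_sub_le _ _).trans (add_le_add h (hK l))
      have h2 : ∑ l, p l * (u (x - α l) - M / (r : ℝ) ^ 2 * sqNorm (x - α l - x₀))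
          = ∑ l, p l * u (x - α l)
            - M / (r : ℝ) ^ 2 * ∑ l, p l * sqNorm (x - x₀ - α l) := by
        rw [Finset.mul_sum, ← Finset.sum_sub_distrib]
        refine Finset.sum_congr rfl fun l _ => ?_
        rw [sub_right_comm]; ring
      rw [h2, sum_mul_sqNorm_sub hmean] at h1
      have h3 : (∑ l, p l) * sqNorm (x - x₀) ≤ 1 * sqNorm (x - x₀) :=
        mul_le_mul_of_nonneg_right hp1 (sqNorm_nonneg _)
      have h4 := mul_le_mul_of_nonneg_left h3 hMr
      have := hu x h
      linarith
    · conv_lhs => rw [parabolicCutoff, if_neg h]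
      linarith

/-- A subharmonic function that is almost maximal at `x₀` in the box of radius `r + K` around
`x₀` is controlled there by its mass. -/
theorem exists_local_bound (hp : ∀ l, 0 ≤ p l) (hp1 : ∑ l, p l ≤ 1)
    (hmean : ∀ j, ∑ l, p l * (α l j : ℝ) = 0) {K : ℕ} (hK : ∀ l, supNorm (α l) ≤ K)
    {c : ℝ} (hc : 0 < c) (hcp : ∀ l, c ≤ p l)
    {a b : Fin d → ι} (hab : ∀ i, a i ≠ b i)
    (hinj : Function.Injective fun j : Fin d → ℕ => ∑ i, j i • (α (a i) - α (b i))) :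
    ∃ C : ℝ, 0 ≤ C ∧ ∀ (u : Grid d → ℝ) (x₀ : Grid d) (r : ℕ), 0 < r → (∀ x, 0 ≤ u x) →
      (∀ x, supNorm (x - x₀) ≤ r → u x ≤ ∑ l, p l * u (x - α l)) →
      (∀ x, supNorm (x - x₀) ≤ r + K → u x ≤ 2 ^ d * u x₀) →
      ∀ A : Finset (Grid d), (∀ x, supNorm (x - x₀) ≤ r → x ∈ A) →
      (r : ℝ) ^ d * u x₀ ≤ C * ∑ x ∈ A, u x := by
  set κ := ∑ l, p l * sqNorm (α l) with hκ
  have hκ0 : 0 ≤ κ := Finset.sum_nonneg fun l _ => mul_nonneg (hp l) (sqNorm_nonneg _)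
  -- `E` is chosen so that `m = r ^ 2 / E` averagings per direction cost at most `u x₀ / 2`; the `+
  -- 1` below keeps it positive.
  obtain ⟨A₀, hA₀⟩ := exists_nat_ge (d * 2 ^ d * κ / c)
  let E : ℕ := A₀ + 1
  have hE : d * 2 ^ d * κ / c ≤ E := hA₀.trans (by simp [E])
  refine ⟨2 * Real.sqrt E ^ d, by positivity, fun u x₀ r hr hu0 hu huM A hA => ?_⟩
  have hr' : (0 : ℝ) < (r : ℝ) ^ 2 := by positivity
  have hM : 0 ≤ 2 ^ d * u x₀ := mul_nonneg (by positivity) (hu0 x₀)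
  have hsub := isSubsolution_parabolicCutoff hp hp1 hmean hK hr hM hu huM
  set f := parabolicCutoff u (2 ^ d * u x₀) r x₀ with hf
  have hfu : ∀ x, f x ≤ u x := by
    intro x
    rw [hf]
    unfold parabolicCutoff
    split_ifs
    · have : 0 ≤ 2 ^ d * u x₀ / (r : ℝ) ^ 2 * sqNorm (x - x₀) :=
        mul_nonneg (by positivity) (sqNorm_nonneg _)
      exact max_le (by linarith) (hu0 x)
    · exact hu0 x
  have hfx₀ : f x₀ = u x₀ := by
    rw [hf, parabolicCutoff, if_pos (by rw [sub_self, supNorm_zero]; exact Nat.zero_le _)]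
    simp [sqNorm, hu0 x₀]
  have hfA : ∀ x ∉ A, f x = 0 := fun x hx => by
    rw [hf, parabolicCutoff, if_neg fun h => hx (hA x h)]
  let m : ℕ := r ^ 2 / E
  have hm1 : (E : ℝ) * m ≤ (r : ℝ) ^ 2 := by exact_mod_cast Nat.mul_div_le (r ^ 2) E
  have hm2 : (r : ℝ) ^ 2 ≤ E * (m + 1) := by
    exact_mod_cast (Nat.lt_mul_div_succ (r ^ 2) (Nat.succ_pos A₀)).le
  have key := hsub.le_sum_support hp1 hc hcp m a b hab hinj hfA x₀
  rw [hfx₀] at key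
  set S := ∑ x ∈ A, u x with hS
  have hS0 : 0 ≤ S := Finset.sum_nonneg fun x _ => hu0 x
  have hfS : ∑ x ∈ A, f x ≤ S := Finset.sum_le_sum fun x _ => hfu x
  have herr : (d : ℝ) * (m * (2 ^ d * u x₀ / (r : ℝ) ^ 2 * κ / (2 * c))) ≤ u x₀ / 2 := by
    have h1 : (d : ℝ) * (m * (2 ^ d * u x₀ / (r : ℝ) ^ 2 * κ / (2 * c)))
        = (d * 2 ^ d * κ / c * m) / (r : ℝ) ^ 2 * (u x₀ / 2) := by
      field_simp
    rw [h1]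
    have h2 : (d * 2 ^ d * κ / c * m) / (r : ℝ) ^ 2 ≤ 1 := by
      rw [div_le_one hr']
      exact (mul_le_mul_of_nonneg_right hE (Nat.cast_nonneg m)).trans hm1
    have h3 : 0 ≤ u x₀ / 2 := by linarith [hu0 x₀]
    calc _ ≤ 1 * (u x₀ / 2) := mul_le_mul_of_nonneg_right h2 h3
      _ = _ := one_mul _
  have hrs : (r : ℝ) * (1 / Real.sqrt (m + 1)) ≤ Real.sqrt E := by
    rw [mul_one_div, div_le_iff₀ (by positivity), ← Real.sqrt_mul (by positivity)]
    exact Real.le_sqrt_of_sq_le hm2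
  have h1 : u x₀ ≤ 2 * ((1 / Real.sqrt (m + 1)) ^ d * S) := by
    have := mul_le_mul_of_nonneg_left hfS (show 0 ≤ (1 / Real.sqrt ((m : ℝ) + 1)) ^ d by positivity)
    linarith
  calc (r : ℝ) ^ d * u x₀ ≤ (r : ℝ) ^ d * (2 * ((1 / Real.sqrt (m + 1)) ^ d * S)) := by gcongr
    _ = 2 * ((r : ℝ) * (1 / Real.sqrt (m + 1))) ^ d * S := by rw [mul_pow]; ring
    _ ≤ 2 * Real.sqrt E ^ d * S := by gcongr

/-- The mean value inequality in a box centered at the origin. -/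
theorem exists_mean_value_bound (hp : ∀ l, 0 ≤ p l) (hp1 : ∑ l, p l ≤ 1)
    (hmean : ∀ j, ∑ l, p l * (α l j : ℝ) = 0) {K : ℕ} (hK : ∀ l, supNorm (α l) ≤ K)
    {c : ℝ} (hc : 0 < c) (hcp : ∀ l, c ≤ p l)
    {a b : Fin d → ι} (hab : ∀ i, a i ≠ b i)
    (hinj : Function.Injective fun j : Fin d → ℕ => ∑ i, j i • (α (a i) - α (b i))) :
    ∃ C : ℝ, 0 ≤ C ∧ ∀ (u : Grid d → ℝ) (R : ℕ), (∀ x, 0 ≤ u x) →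
      (∀ x, supNorm x ≤ R → u x ≤ ∑ l, p l * u (x - α l)) →
      ((R : ℝ) + 1) ^ d * u 0 ≤ C * ∑ x ∈ boxFinset d R, u x := by
  obtain ⟨C, hC, hloc⟩ := exists_local_bound hp hp1 hmean hK hc hcp hab hinj
  refine ⟨(2 * K + 3) ^ d * (C + 1), by positivity, fun u R hu0 hu => ?_⟩
  have h0 : (0 : Grid d) ∈ boxFinset d R := mem_boxFinset.2 (by rw [supNorm_zero]; omega)
  -- Weighting by the `d`-th power of the distance to the boundary bounds the value at 0 and also
  -- limits the growth of `u` around `x₀`.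
  obtain ⟨x₀, hx₀, hmax⟩ := Finset.exists_max_image (boxFinset d R)
    (fun x => ((R + 1 - supNorm x : ℕ) : ℝ) ^ d * u x) ⟨0, h0⟩
  have hx₀R := mem_boxFinset.1 hx₀
  set h : ℕ := R + 1 - supNorm x₀ with hh
  set S := ∑ x ∈ boxFinset d R, u x with hS
  have hS0 : 0 ≤ S := Finset.sum_nonneg fun x _ => hu0 x
  have hleft : ((R : ℝ) + 1) ^ d * u 0 ≤ (h : ℝ) ^ d * u x₀ := by
    have := hmax 0 h0
    simpa [supNorm_zero] using this
  refine hleft.trans ?_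
  have htri : ∀ x : Grid d, supNorm x ≤ supNorm (x - x₀) + supNorm x₀ := fun x => by
    simpa using supNorm_add_le (x - x₀) x₀
  by_cases hsmall : h / 2 ≤ K
  · have h1 : (h : ℝ) ≤ 2 * K + 3 := by
      have : h ≤ 2 * K + 3 := by omega
      exact_mod_cast this
    have h2 : u x₀ ≤ S := Finset.single_le_sum (fun x _ => hu0 x) hx₀
    calc (h : ℝ) ^ d * u x₀ ≤ (2 * K + 3) ^ d * S := by gcongr; exact hu0 _
      _ ≤ (2 * K + 3) ^ d * (C + 1) * S := by
        rw [mul_assoc]; gcongr; nlinarith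
  · obtain ⟨r, hr⟩ : ∃ r, h / 2 = r + K := ⟨h / 2 - K, by omega⟩
    have hr0 : 0 < r := by omega
    have hhr : (h : ℝ) ≤ (2 * K + 3) * r := by
      have h1 : h ≤ 2 * (r + K) + 1 := by omega
      have h2 : 2 * (r + K) + 1 ≤ (2 * K + 3) * r := by nlinarith
      exact_mod_cast h1.trans h2
    have hbox : ∀ x, supNorm (x - x₀) ≤ r + K → supNorm x ≤ R := fun x hx => by
      have := htri x; omega
    have key := hloc u x₀ r hr0 hu0 (fun x hx => hu x (hbox x (by omega))) (fun x hx => ?_)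
      (boxFinset d R) (fun x hx => mem_boxFinset.2 (hbox x (by omega)))
    · calc (h : ℝ) ^ d * u x₀ ≤ ((2 * K + 3) * r) ^ d * u x₀ := by gcongr; exact hu0 _
        _ = (2 * K + 3) ^ d * ((r : ℝ) ^ d * u x₀) := by rw [mul_pow]; ring
        _ ≤ (2 * K + 3) ^ d * (C * S) := by gcongr
        _ ≤ (2 * K + 3) ^ d * (C + 1) * S := by
          rw [mul_assoc]; gcongr; linarith
    -- Within `h / 2` of `x₀` the distance to the boundary at most halves, hence `u x ≤ 2 ^ d * u
    -- x₀`.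
    · have h1 := hmax x (mem_boxFinset.2 (hbox x hx))
      have h2 : h ≤ 2 * (R + 1 - supNorm x) := by
        have := htri x; omega
      have h3 : (h : ℝ) ≤ 2 * ((R + 1 - supNorm x : ℕ) : ℝ) := by exact_mod_cast h2
      have hpos : (0 : ℝ) < (h : ℝ) ^ d := by
        have : 0 < h := by omega
        positivity
      refine le_of_mul_le_mul_left ?_ hpos
      calc (h : ℝ) ^ d * u x ≤ (2 * ((R + 1 - supNorm x : ℕ) : ℝ)) ^ d * u x := by
            gcongr; exact hu0 _
        _ = 2 ^ d * (((R + 1 - supNorm x : ℕ) : ℝ) ^ d * u x) := by rw [mul_pow]; ring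
        _ ≤ 2 ^ d * ((h : ℝ) ^ d * u x₀) := by gcongr
        _ = (h : ℝ) ^ d * (2 ^ d * u x₀) := by ring

end MeanValue

/-! ### Reproducing filters -/

section Reproducing

variable {d : ℕ}

/-- A bounded point evaluation on a subspace of `ℂ^B` is an inner product. -/
theorem exists_reproducing_vector {B : Type*} [Fintype B] [DecidableEq B]
    (W : Submodule ℂ (EuclideanSpace ℂ B)) (i : B) {ρ : ℝ} (hρ : 0 ≤ ρ)
    (hW : ∀ v ∈ W, ‖v i‖ ≤ ρ * ‖v‖) :
    ∃ q : EuclideanSpace ℂ B, ‖q‖ ≤ ρ ∧ ∀ v ∈ W, ∑ b, starRingEnd ℂ (q b) * v b = v i := by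
  let q : W := W.orthogonalProjectionOnto (EuclideanSpace.single i (1 : ℂ))
  have hq : ∀ v ∈ W, inner ℂ (q : EuclideanSpace ℂ B) v = v i := by
    intro v hv
    have h := Submodule.inner_orthogonalProjectionOnto_eq_of_mem_right (K := W) ⟨v, hv⟩
      (EuclideanSpace.single i (1 : ℂ))
    rw [EuclideanSpace.inner_single_left, map_one, one_mul] at h
    exact h
  refine ⟨q, ?_, fun v hv => ?_⟩
  -- Testing the evaluation on `q` itself gives `‖q‖ ^ 2 = ‖q i‖ ≤ ρ ‖q‖`.
  · have h1 := hW q q.2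
    rw [← hq q q.2, inner_self_eq_norm_sq_to_K] at h1
    have h2 : ‖(q : EuclideanSpace ℂ B)‖ ^ 2 ≤ ρ * ‖(q : EuclideanSpace ℂ B)‖ := by
      simpa using h1
    rcases (norm_nonneg (q : EuclideanSpace ℂ B)).eq_or_lt with h0 | h0
    · rw [← h0]; exact hρ
    · rw [sq] at h2
      exact le_of_mul_le_mul_right h2 h0
  · rw [← hq v hv, PiLp.inner_apply]
    exact Finset.sum_congr rfl fun b _ => by rw [RCLike.inner_apply, mul_comm]

theorem Filt.apply_eq_sum_boxFinset {q : Filt d} {T : ℕ} (hq : q.OrdLE T) (x : Field d)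
    (τ : Grid d) : q.apply x τ = ∑ ν ∈ boxFinset d T, q ν * x (τ - ν) := by
  refine Finsupp.sum_of_support_subset _ (fun ν hν => ?_) _ (fun _ _ => zero_mul _)
  rw [mem_boxFinset]
  by_contra h
  exact Finsupp.mem_support_iff.1 hν (hq ν (by omega))

theorem Filt.l2norm_eq_sum_boxFinset {q : Filt d} {T : ℕ} (hq : q.OrdLE T) :
    q.l2norm = Real.sqrt (∑ ν ∈ boxFinset d T, ‖q ν‖ ^ 2) := by
  rw [Filt.l2norm, Finsupp.sum_of_support_subset _ (fun ν hν => ?_) _ (fun _ _ => by simp)]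
  rw [mem_boxFinset]
  by_contra h
  exact Finsupp.mem_support_iff.1 hν (hq ν (by omega))

/-- The fields that solve `s = D s` at all points at distance at least `K` from the complement of
the box of radius `T` around the origin. -/
def DiffOp.localSolutions (D : DiffOp d) (K T : ℕ) : Submodule ℂ (Field d) where
  carrier := {s | ∀ x, supNorm x + K ≤ T → s x = D.apply s x}
  zero_mem' := fun x _ => by simp [DiffOp.apply]
  add_mem' := fun {s s'} hs hs' x hx => by
    rw [Pi.add_apply, hs x hx, hs' x hx]
    simp only [DiffOp.apply, Pi.add_apply, mul_add, Finset.sum_add_distrib]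
  smul_mem' := fun z s hs x hx => by
    rw [Pi.smul_apply, hs x hx]
    simp only [DiffOp.apply, Pi.smul_apply, smul_eq_mul, Finset.mul_sum]
    exact Finset.sum_congr rfl fun l _ => by ring

/-- By the triangle inequality `‖s‖` is subharmonic on the box of radius `T - K`. The factor `(2K +
2) ^ d` pays for the lost collar, and for `T < K` it makes the bound trivial. -/
theorem DiffOp.IsRegular.exists_mean_value_bound {D : DiffOp d} (hD : D.IsRegular) :
    ∃ (K : ℕ) (C : ℝ), (∀ l, supNorm (D.α l) ≤ K) ∧ 1 ≤ C ∧ ∀ T, ∀ s ∈ D.localSolutions K T,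
      (2 * (T : ℝ) + 1) ^ d * ‖s 0‖ ≤ C * ∑ x ∈ boxFinset d T, ‖s x‖ := by
  obtain ⟨a, b, hab, hinj⟩ := hD.exists_injective_directions
  obtain ⟨c, hc, hcw⟩ : ∃ c : ℝ, 0 < c ∧ ∀ l, c ≤ ‖D.w l‖ := by
    rcases isEmpty_or_nonempty (Fin D.k) with h | h
    · exact ⟨1, one_pos, fun l => h.elim l⟩
    · obtain ⟨l₀, hl₀⟩ := Finite.exists_min fun l => ‖D.w l‖
      exact ⟨_, norm_pos_iff.2 (hD.weight_ne_zero l₀), hl₀⟩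
  let K : ℕ := Finset.univ.sup fun l => supNorm (D.α l)
  have hK : ∀ l, supNorm (D.α l) ≤ K := fun l =>
    Finset.le_sup (f := fun l => supNorm (D.α l)) (Finset.mem_univ l)
  have hmean : ∀ j, ∑ l, ‖D.w l‖ * (D.α l j : ℝ) = 0 := fun j => by
    simpa [Finset.sum_apply, DiffOp.realShift] using congrFun hD.weighted_mean_eq_zero j
  obtain ⟨C, hC, hmv⟩ := WellFiltered.exists_mean_value_bound (fun l => norm_nonneg (D.w l))
    hD.sum_norm_le_one hmean hK hc hcw hab hinj
  refine ⟨K, (2 * K + 2) ^ d * (C + 1), hK, ?_, fun T s hs => ?_⟩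
  · exact one_le_mul_of_one_le_of_one_le
      (one_le_pow₀ (by have : (0 : ℝ) ≤ K := Nat.cast_nonneg K; linarith)) (by linarith)
  set S := ∑ x ∈ boxFinset d T, ‖s x‖ with hS
  have hS0 : 0 ≤ S := Finset.sum_nonneg fun x _ => norm_nonneg _
  rcases lt_or_ge T K with hT | hT
  · have h1 : 2 * (T : ℝ) + 1 ≤ 2 * K + 2 := by
      have : 2 * T + 1 ≤ 2 * K + 2 := by omega
      exact_mod_cast this
    have h2 : ‖s 0‖ ≤ S := Finset.single_le_sum (f := fun x => ‖s x‖) (fun x _ => norm_nonneg _)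
      (mem_boxFinset.2 (by rw [supNorm_zero]; omega))
    calc (2 * (T : ℝ) + 1) ^ d * ‖s 0‖ ≤ (2 * K + 2) ^ d * S := by gcongr
      _ ≤ (2 * K + 2) ^ d * (C + 1) * S := by rw [mul_assoc]; gcongr; nlinarith
  · obtain ⟨R, rfl⟩ := Nat.exists_eq_add_of_le' hT
    have h1 := hmv (fun x => ‖s x‖) R (fun x => norm_nonneg _) fun x hx => by
      rw [hs x (by omega)]
      refine (norm_sum_le _ _).trans (Finset.sum_le_sum fun l _ => ?_)
      rw [norm_mul]
    have h2 : ∑ x ∈ boxFinset d R, ‖s x‖ ≤ S :=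
      Finset.sum_le_sum_of_subset_of_nonneg
        (fun x hx => mem_boxFinset.2 ((mem_boxFinset.1 hx).trans (by omega)))
        fun _ _ _ => norm_nonneg _
    have h3 : 2 * ((R + K : ℕ) : ℝ) + 1 ≤ (2 * K + 2) * (R + 1) := by
      have : 2 * (R + K) + 1 ≤ (2 * K + 2) * (R + 1) := by nlinarith [Nat.zero_le (K * R)]
      exact_mod_cast this
    calc (2 * ((R + K : ℕ) : ℝ) + 1) ^ d * ‖s 0‖
        ≤ ((2 * K + 2) * (R + 1)) ^ d * ‖s 0‖ := by gcongr
      _ = (2 * K + 2) ^ d * (((R : ℝ) + 1) ^ d * ‖s 0‖) := by rw [mul_pow]; ring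
      _ ≤ (2 * K + 2) ^ d * (C * S) := by
        refine mul_le_mul_of_nonneg_left (h1.trans ?_) (by positivity)
        gcongr
      _ ≤ (2 * K + 2) ^ d * (C + 1) * S := by rw [mul_assoc]; gcongr; linarith

theorem DiffOp.IsRegular.exists_reproducing_filter {D : DiffOp d} (hD : D.IsRegular) :
    ∃ (K : ℕ) (C : ℝ), (∀ l, supNorm (D.α l) ≤ K) ∧ 1 ≤ C ∧ ∀ T : ℕ, ∃ q : Filt d, q.OrdLE T ∧
      q.l2norm ≤ C / (2 * (T : ℝ) + 1) ^ ((d : ℝ) / 2) ∧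
      ∀ s ∈ D.localSolutions K T, q.apply s 0 = s 0 := by
  classical
  obtain ⟨K, C, hK, hC, hmv⟩ := hD.exists_mean_value_bound
  refine ⟨K, C, hK, hC, fun T => ?_⟩
  -- The reflection matches the convolution, which at 0 pairs `q ν` with `s (-ν)`.
  let Λ : Field d →ₗ[ℂ] EuclideanSpace ℂ (boxFinset d T) :=
    (WithLp.linearEquiv 2 ℂ (boxFinset d T → ℂ)).symm.toLinearMap ∘ₗ
      LinearMap.funLeft ℂ ℂ fun ν : boxFinset d T => -(ν : Grid d)
  have hΛ : ∀ s ν, Λ s ν = s (-(ν : Grid d)) := fun _ _ => rfl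
  have h0 : (0 : Grid d) ∈ boxFinset d T := mem_boxFinset.2 (by rw [supNorm_zero]; omega)
  set X : ℝ := (2 * (T : ℝ) + 1) ^ ((d : ℝ) / 2) with hX
  have hXpos : 0 < X := by positivity
  have hXsq : X ^ 2 = (2 * (T : ℝ) + 1) ^ d := by
    rw [hX, ← Real.rpow_natCast, ← Real.rpow_mul (by positivity), ← Real.rpow_natCast]
    congr 1
    push_cast
    ring
  have hneg : ∀ g : Grid d → ℝ,
      ∑ x ∈ boxFinset d T, g x = ∑ ν : boxFinset d T, g (-(ν : Grid d)) := by
    intro g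
    rw [Finset.sum_coe_sort (boxFinset d T) fun ν => g (-ν)]
    refine Finset.sum_equiv (Equiv.neg _) (fun x => ?_) (fun x _ => by simp)
    simp only [mem_boxFinset, Equiv.neg_apply, supNorm_neg]
  have hnorm : ∀ s ∈ D.localSolutions K T, ‖s 0‖ ≤ C / X * ‖Λ s‖ := by
    intro s hs
    have h1 := hmv T s hs
    have h2 : ∑ x ∈ boxFinset d T, ‖s x‖ ≤ X * ‖Λ s‖ := by
      refine le_of_sq_le_sq ?_ (by positivity)
      rw [mul_pow, hXsq, EuclideanSpace.norm_sq_eq]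
      refine (sq_sum_le_card_mul_sum_sq).trans (le_of_eq ?_)
      rw [card_boxFinset, hneg fun x => ‖s x‖ ^ 2]
      push_cast
      rfl
    rw [← hXsq] at h1
    rw [div_mul_eq_mul_div, le_div_iff₀ hXpos]
    refine le_of_mul_le_mul_left ?_ hXpos
    calc X * (‖s 0‖ * X) = X ^ 2 * ‖s 0‖ := by ring
      _ ≤ C * ∑ x ∈ boxFinset d T, ‖s x‖ := h1
      _ ≤ C * (X * ‖Λ s‖) := by gcongr
      _ = X * (C * ‖Λ s‖) := by ring
  obtain ⟨v, hv, hrep⟩ := exists_reproducing_vector ((D.localSolutions K T).map Λ) ⟨0, h0⟩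
    (ρ := C / X) (by positivity) (by
      rintro _ ⟨s, hs, rfl⟩
      simpa [hΛ] using hnorm s hs)
  let q : Filt d := Finsupp.onFinset (boxFinset d T)
    (fun ν => if h : ν ∈ boxFinset d T then starRingEnd ℂ (v ⟨ν, h⟩) else 0)
    (fun ν hν => by by_contra h; exact hν (dif_neg h))
  have hq : ∀ ν : boxFinset d T, q ν = starRingEnd ℂ (v ν) := fun ν => dif_pos ν.2
  have hord : q.OrdLE T := fun ν hν => dif_neg fun h => by
    have := mem_boxFinset.1 h; omega
  refine ⟨q, hord, ?_, fun s hs => ?_⟩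
  · rw [Filt.l2norm_eq_sum_boxFinset hord, ← Finset.sum_coe_sort]
    refine le_trans (le_of_eq ?_) hv
    rw [EuclideanSpace.norm_eq]
    simp only [hq, RCLike.norm_conj]
  · have h1 := hrep (Λ s) ⟨s, hs, rfl⟩
    rw [Filt.apply_eq_sum_boxFinset hord, ← Finset.sum_coe_sort]
    simpa [hq, hΛ] using h1

/-- If `|x| + K ≤ T`, then `τ + x` and all its shifts stay within `|τ - t| + T ≤ N` of `t`, so the
equation is available at `τ + x`. -/
theorem DiffOp.translate_mem_localSolutions {D : DiffOp d} {K : ℕ}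
    (hK : ∀ l, supNorm (D.α l) ≤ K) {t τ : Grid d} {N T : ℕ} {s : Field d}
    (hs : s ∈ D.solutions t N) (hτ : supNorm (τ - t) + T ≤ N) :
    (fun x => s (τ + x)) ∈ D.localSolutions K T := by
  intro x hx
  have h1 : supNorm (τ + x - t) ≤ supNorm (τ - t) + supNorm x := by
    rw [add_sub_right_comm]; exact supNorm_add_le _ _
  have h2 := hs (τ + x) ⟨by change supNorm _ ≤ N; omega, fun l => by
    have h3 : supNorm (τ + x + D.α l - t) ≤ supNorm (τ + x - t) + supNorm (D.α l) := by
      rw [add_sub_right_comm]; exact supNorm_add_le _ _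
    have := hK l
    change supNorm _ ≤ N
    omega⟩
  simpa only [DiffOp.apply, add_sub_assoc] using h2

end Reproducing

end WellFiltered

theorem mainTheorem3 {d : ℕ} (D : WellFiltered.DiffOp d) (hD : D.IsRegular) :
    ∃ c : ℝ, 0 < c ∧
      ∀ N : ℕ, 0 < N → ∀ t : WellFiltered.Grid d, ∀ s ∈ D.solutions t N,
        ∀ (Ω : Type*) [MeasurableSpace Ω] (P : MeasureTheory.Measure Ω)
          [MeasureTheory.IsProbabilityMeasure P],
          WellFiltered.Field.toRandom Ω s ∈
            WellFiltered.wellFiltered P t ((⌊c * (N : ℝ)⌋₊ : ℕ) : ℕ∞) 0 c⁻¹ := by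
  obtain ⟨K, C, hK, hC, hrep⟩ := hD.exists_reproducing_filter
  have hC2 : (0 : ℝ) < 2 * C := by linarith
  -- One constant plays two roles: `c⁻¹ = 2C` dominates both `C` and 1, and `c ≤ 1/2` (as `C ≥ 1`)
  -- gives `|τ - t| + T ≤ N`.
  refine ⟨(2 * C)⁻¹, by positivity, fun N _ t s hs Ω _ P _ T hT => ?_⟩
  rw [inv_inv]
  obtain ⟨q, hord, hnorm, hq⟩ := hrep T
  have hfloor : 2 * ⌊(2 * C)⁻¹ * (N : ℝ)⌋₊ ≤ N := by
    have h1 : (⌊(2 * C)⁻¹ * (N : ℝ)⌋₊ : ℝ) ≤ (2 * C)⁻¹ * N := Nat.floor_le (by positivity)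
    have h2 : (2 * C)⁻¹ ≤ (2 : ℝ)⁻¹ := inv_anti₀ two_pos (by linarith)
    have h3 : (2 * C)⁻¹ * (N : ℝ) ≤ 2⁻¹ * N := by gcongr
    have : 2 * (⌊(2 * C)⁻¹ * (N : ℝ)⌋₊ : ℝ) ≤ N := by linarith
    exact_mod_cast this
  have hT' : T ≤ ⌊(2 * C)⁻¹ * (N : ℝ)⌋₊ := by exact_mod_cast hT
  refine ⟨le_rfl, by linarith, q, hord, hnorm.trans (by gcongr; linarith), fun τ hτ => ?_⟩
  have hτ' : WellFiltered.supNorm (τ - t) ≤ ⌊(2 * C)⁻¹ * (N : ℝ)⌋₊ := by exact_mod_cast hτ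
  have h := hq _ (WellFiltered.DiffOp.translate_mem_localSolutions hK hs
    (τ := τ) (T := T) (by omega))
  have h' : q.apply s τ = s τ := by
    simpa only [WellFiltered.Filt.apply, add_zero, zero_sub, ← sub_eq_add_neg] using h
  simp [WellFiltered.Field.toRandom, h']
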